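/- For $a,q\in\mathbb{C}$ with $|q|<1$ write $(a;q)_n=\prod_{k=0}^{n-1}(1-aq^k)$ for $n\ge 0$ (so $(a;q)_0=1$), $(a;q)_\infty=\prod_{k=0}^{\infty}(1-aq^k)$, and $(a_1,\dots,a_m;q)_\infty=(a_1;q)_\infty\cdots(a_m;q)_\infty$. Then for every complex number $q$ with $|q|<1$ the series below converges absolutely and $$\sum_{n=0}^{\infty}\frac{(q;q)_{3n}\,(-q^3;q^3)_n}{(q^3;q^3)_n\,(q^3;q^3)_{2n}}\,q^{\frac{3n^2-3n}{2}}=\frac{(-q^3;q^3)_\infty}{(q^3;q^3)_\infty}\left[(q,q^5,q^6;q^6)_\infty+(q^2,q^4,q^6;q^6)_\infty\right]$$ (with the convention $q^0=1$, also for $q=0$). -/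

import Mathlib

/-- The finite `q`-shifted factorial `(a; q)_n = ∏_{k=0}^{n-1} (1 - a q^k)`. -/
noncomputable def qShifted (a q : ℂ) (n : ℕ) : ℂ :=
  ∏ k ∈ Finset.range n, (1 - a * q ^ k)

/-- The infinite `q`-shifted factorial `(a; q)_∞ = ∏_{k=0}^{∞} (1 - a q^k)`. -/
noncomputable def qShiftedInf (a q : ℂ) : ℂ :=
  ∏' k : ℕ, (1 - a * q ^ k)

/-- For `|q| < 1` the infinite product converges absolutely, so that `qShiftedInf` is
its genuine value. -/
theorem hasProd_qShiftedInf (a q : ℂ) (hq : ‖q‖ < 1) :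
    HasProd (fun k : ℕ => 1 - a * q ^ k) (qShiftedInf a q) := by
  have hs : Summable (fun k : ℕ => ‖-(a * q ^ k)‖) := by
    simp only [norm_neg, norm_mul, norm_pow]
    exact (summable_geometric_of_lt_one (norm_nonneg q) hq).mul_left _
  have hm := multipliable_one_add_of_summable hs
  simp only [← sub_eq_add_neg] at hm
  exact hm.hasProd

/-!
The summand is a `q`-hypergeometric term in base `p = q³`: since
`(q;q)_{3n} = (q;p)_n (q²;p)_n (p;p)_n` and `(p;p)_{2n} = (p;p²)_n (p;p)_n (-p;p)_n`, it equals
`(a;p)_n (b;p)_n p^{n(n-1)/2} / ((p;p)_n (ab;p²)_n)` at `a = q`, `b = q²`, where `ab = p`.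

Write `q` for the base from here on. For general `a`, `b` in the unit disc, a telescoping argument
(`contiguous_split`) writes `1 - ab` times this series as `(1 - a) G(aq, b) + (1 - b) G(a, bq)`, where
`G(a, b) = ∑ (a;q)_n (b;q)_n q^{n(n+1)/2} / ((q;q)_n (abq;q²)_n)` is Andrews' `q`-analogue of Gauss'
second summation, `G(a, b) = (-q;q)_∞ (aq;q²)_∞ (bq;q²)_∞ / (abq;q²)_∞` (`gauss_second`). This is
where the two products on the right-hand side come from.

For `gauss_second`, a second telescoping gives `(1 - abq) G(a, b) = (1 - aq) G(aq², b)`. Iterating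
it moves `a` to `0`, and then, by symmetry, `b` to `0`, which leaves Euler's sum `G(0, 0) = (-q;q)_∞`
(`euler_sum`), itself proved by iterating `z ↦ zq`. All limits are justified by the one uniform
bound `norm_qTerm_le`.
-/

open Filter Topology

/-! ### Finite and infinite shifted factorials -/

theorem qShifted_succ (a q : ℂ) (n : ℕ) :
    qShifted a q (n + 1) = qShifted a q n * (1 - a * q ^ n) :=
  Finset.prod_range_succ _ _

theorem one_sub_mul_qShifted (a q : ℂ) (n : ℕ) :
    (1 - a) * qShifted (a * q) q n = qShifted a q n * (1 - a * q ^ n) := by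
  rw [← qShifted_succ, qShifted, qShifted, Finset.prod_range_succ']
  simp [pow_succ', mul_assoc, mul_comm]

theorem one_sub_ne_zero_of_norm_lt {x : ℂ} (hx : ‖x‖ < 1) : 1 - x ≠ 0 := by
  intro h
  rw [← sub_eq_zero.1 h] at hx
  simp at hx

theorem norm_mul_pow_le {d q : ℂ} (hq : ‖q‖ ≤ 1) (k : ℕ) : ‖d * q ^ k‖ ≤ ‖d‖ := by
  rw [norm_mul, norm_pow]
  exact mul_le_of_le_one_right (norm_nonneg _) (pow_le_one₀ (norm_nonneg _) hq)

theorem one_sub_mul_pow_ne_zero {d q : ℂ} (hd : ‖d‖ < 1) (hq : ‖q‖ ≤ 1) (k : ℕ) :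
    1 - d * q ^ k ≠ 0 :=
  one_sub_ne_zero_of_norm_lt ((norm_mul_pow_le hq k).trans_lt hd)

theorem qShifted_ne_zero {d q : ℂ} (hd : ‖d‖ < 1) (hq : ‖q‖ ≤ 1) (n : ℕ) :
    qShifted d q n ≠ 0 :=
  Finset.prod_ne_zero_iff.2 fun k _ => one_sub_mul_pow_ne_zero hd hq k

theorem qShiftedInf_ne_zero {d q : ℂ} (hd : ‖d‖ < 1) (hq : ‖q‖ < 1) : qShiftedInf d q ≠ 0 := by
  have hs : Summable (fun k : ℕ => ‖-(d * q ^ k)‖) := by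
    simp only [norm_neg, norm_mul, norm_pow]
    exact (summable_geometric_of_lt_one (norm_nonneg q) hq).mul_left _
  have h := tprod_one_add_ne_zero_of_summable (f := fun k : ℕ => -(d * q ^ k))
    (fun k => by simpa [← sub_eq_add_neg] using one_sub_mul_pow_ne_zero hd hq.le k) hs
  simpa [qShiftedInf, ← sub_eq_add_neg] using h

theorem tendsto_qShifted {q : ℂ} (a : ℂ) (hq : ‖q‖ < 1) :
    Tendsto (qShifted a q) atTop (𝓝 (qShiftedInf a q)) :=
  (hasProd_qShiftedInf a q hq).tendsto_prod_nat

theorem qShiftedInf_zero_left (q : ℂ) : qShiftedInf 0 q = 1 := by simp [qShiftedInf]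

theorem one_sub_mul_qShiftedInf {q : ℂ} (a : ℂ) (hq : ‖q‖ < 1) :
    (1 - a) * qShiftedInf (a * q) q = qShiftedInf a q := by
  refine tendsto_nhds_unique ((tendsto_qShifted (a * q) hq).const_mul (1 - a)) ?_
  refine ((tendsto_qShifted a hq).comp (tendsto_add_atTop_nat 1)).congr fun n => ?_
  rw [Function.comp_apply, qShifted_succ, one_sub_mul_qShifted]

theorem qShifted_two_mul (a q : ℂ) (n : ℕ) :
    qShifted a q (2 * n) = qShifted a (q ^ 2) n * qShifted (a * q) (q ^ 2) n := by
  induction n with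
  | zero => simp [qShifted]
  | succ n ih =>
    rw [show 2 * (n + 1) = 2 * n + 1 + 1 by ring, qShifted_succ, qShifted_succ, ih, qShifted_succ,
      qShifted_succ]
    ring

theorem qShifted_three_mul (a q : ℂ) (n : ℕ) :
    qShifted a q (3 * n) =
      qShifted a (q ^ 3) n * qShifted (a * q) (q ^ 3) n * qShifted (a * q ^ 2) (q ^ 3) n := by
  induction n with
  | zero => simp [qShifted]
  | succ n ih =>
    rw [show 3 * (n + 1) = 3 * n + 1 + 1 + 1 by ring, qShifted_succ, qShifted_succ, qShifted_succ,
      ih, qShifted_succ, qShifted_succ, qShifted_succ]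
    ring

theorem qShifted_sq (a q : ℂ) (n : ℕ) :
    qShifted (a ^ 2) (q ^ 2) n = qShifted a q n * qShifted (-a) q n := by
  rw [qShifted, qShifted, qShifted, ← Finset.prod_mul_distrib]
  exact Finset.prod_congr rfl fun k _ => by ring

theorem qShiftedInf_eq_mul {q : ℂ} (a : ℂ) (hq : ‖q‖ < 1) :
    qShiftedInf a q = qShiftedInf a (q ^ 2) * qShiftedInf (a * q) (q ^ 2) := by
  have hq2 : ‖q ^ 2‖ < 1 := by
    rw [norm_pow]; exact pow_lt_one₀ (norm_nonneg _) hq two_ne_zero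
  refine tendsto_nhds_unique ((tendsto_qShifted a hq).comp
    (tendsto_id.const_mul_atTop' (r := 2) two_pos)) ?_
  refine ((tendsto_qShifted a hq2).mul (tendsto_qShifted (a * q) hq2)).congr fun n => ?_
  simp [qShifted_two_mul]

/-- Iterating a first-order relation `(1 - c rᴺ) F(N) = (1 - e rᴺ) F(N + 1)` along a convergent
sequence turns its coefficients into infinite products. -/
theorem mul_qShiftedInf_eq_of_rec {F : ℕ → ℂ} {L c e r : ℂ} (hr : ‖r‖ < 1)
    (hF : Tendsto F atTop (𝓝 L))
    (h : ∀ N, F N * (1 - c * r ^ N) = (1 - e * r ^ N) * F (N + 1)) :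
    F 0 * qShiftedInf c r = qShiftedInf e r * L := by
  have key (N : ℕ) : F 0 * qShifted c r N = qShifted e r N * F N := by
    induction N with
    | zero => simp [qShifted]
    | succ N ih =>
      rw [qShifted_succ, qShifted_succ]
      linear_combination (1 - c * r ^ N) * ih + qShifted e r N * h N
  refine tendsto_nhds_unique ((tendsto_qShifted c hr).const_mul (F 0)) ?_
  exact ((tendsto_qShifted e hr).mul hF).congr fun N => (key N).symm

/-! ### The common series and its convergence -/

/-- The term `(a;q)_n (b;q)_n zⁿ q^{n(n-1)/2} / ((q;q)_n (d;q²)_n)`. Every series in this file is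
of this form. -/
noncomputable def qTerm (q z a b d : ℂ) (n : ℕ) : ℂ :=
  qShifted a q n * qShifted b q n * (z ^ n * q ^ n.choose 2) /
    (qShifted q q n * qShifted d (q ^ 2) n)

theorem qTerm_comm (q z a b d : ℂ) : qTerm q z a b d = qTerm q z b a d := by
  ext n
  rw [qTerm, qTerm, mul_comm (qShifted a q n)]

theorem norm_qShifted_le {a q : ℂ} (ha : ‖a‖ ≤ 1) (hq : ‖q‖ ≤ 1) (n : ℕ) :
    ‖qShifted a q n‖ ≤ 2 ^ n := by
  rw [qShifted, norm_prod]
  refine (Finset.prod_le_prod (g := fun _ => 2) (fun _ _ => norm_nonneg _) fun k _ => ?_).trans_eq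
    (by simp)
  have h1 := norm_sub_le (1 : ℂ) (a * q ^ k)
  have h2 := norm_mul_pow_le (d := a) hq k
  rw [norm_one] at h1
  linarith

theorem pow_le_norm_qShifted {d q : ℂ} {r : ℝ} (hd : ‖d‖ ≤ r) (hr : r < 1) (hq : ‖q‖ ≤ 1) (n : ℕ) :
    (1 - r) ^ n ≤ ‖qShifted d q n‖ := by
  rw [qShifted, norm_prod]
  calc (1 - r) ^ n = ∏ _k ∈ Finset.range n, (1 - r) := by simp
    _ ≤ _ := Finset.prod_le_prod (fun _ _ => by linarith) fun k _ => by
      have h1 := norm_sub_norm_le (1 : ℂ) (d * q ^ k)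
      have h2 := norm_mul_pow_le (d := d) hq k
      rw [norm_one] at h1
      linarith

/-- A bound on the terms that depends on the parameters only through `r`. -/
theorem norm_qTerm_le {q z a b d : ℂ} {r : ℝ} (hr : r < 1) (hq : ‖q‖ ≤ r) (hz : ‖z‖ ≤ 1)
    (ha : ‖a‖ ≤ 1) (hb : ‖b‖ ≤ 1) (hd : ‖d‖ ≤ r) (n : ℕ) :
    ‖qTerm q z a b d n‖ ≤ (4 / (1 - r) ^ 2) ^ n * ‖q‖ ^ n.choose 2 := by
  have hq1 : ‖q‖ ≤ 1 := hq.trans hr.le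
  have hq2 : ‖q ^ 2‖ ≤ 1 := by rw [norm_pow]; exact pow_le_one₀ (norm_nonneg _) hq1
  have h0 : 0 < 1 - r := by linarith
  have hz' : ‖z‖ ^ n ≤ 1 := pow_le_one₀ (norm_nonneg _) hz
  rw [qTerm, norm_div, norm_mul, norm_mul, norm_mul, norm_mul, norm_pow, norm_pow]
  calc _ ≤ 2 ^ n * 2 ^ n * (1 * ‖q‖ ^ n.choose 2) / ((1 - r) ^ n * (1 - r) ^ n) := by
        gcongr
        · exact norm_qShifted_le ha hq1 n
        · exact norm_qShifted_le hb hq1 n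
        · exact pow_le_norm_qShifted hq hr hq1 n
        · exact pow_le_norm_qShifted hd hr hq2 n
    _ = _ := by
        rw [← mul_pow, ← mul_pow, one_mul, mul_div_right_comm, ← div_pow]
        norm_num [sq]

theorem summable_pow_mul_pow_choose {q : ℂ} (hq : ‖q‖ < 1) (K : ℝ) :
    Summable fun n : ℕ => K ^ n * ‖q‖ ^ n.choose 2 := by
  refine summable_of_ratio_norm_eventually_le (r := 1 / 2) (by norm_num) ?_
  have h : Tendsto (fun n : ℕ => |K| * ‖q‖ ^ n) atTop (𝓝 (|K| * 0)) :=
    (tendsto_pow_atTop_nhds_zero_of_lt_one (norm_nonneg _) hq).const_mul _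
  rw [mul_zero] at h
  filter_upwards [h.eventually_le_const (show (0 : ℝ) < 1 / 2 by norm_num)] with n hn
  rw [Nat.choose_succ_succ' n 1, Nat.choose_one_right]
  simp only [norm_mul, norm_pow, Real.norm_eq_abs, abs_norm, Nat.reduceAdd]
  calc |K| ^ (n + 1) * ‖q‖ ^ (n + n.choose 2)
      = (|K| * ‖q‖ ^ n) * (|K| ^ n * ‖q‖ ^ n.choose 2) := by ring
    _ ≤ _ := by gcongr

theorem summable_qTerm {q z a b d : ℂ} (hq : ‖q‖ < 1) (hz : ‖z‖ ≤ 1)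
    (ha : ‖a‖ ≤ 1) (hb : ‖b‖ ≤ 1) (hd : ‖d‖ < 1) : Summable (qTerm q z a b d) :=
  .of_norm_bounded (summable_pow_mul_pow_choose hq _)
    (norm_qTerm_le (max_lt hq hd) (le_max_left _ _) hz ha hb (le_max_right _ _))

theorem qTerm_mul_right (q z a b d : ℂ) (n : ℕ) :
    qTerm q (z * q) a b d n = qTerm q z a b d n * q ^ n := by
  rw [qTerm, qTerm, mul_pow]
  ring

theorem tendsto_qShifted_left {a : ℕ → ℂ} {a₀ : ℂ} (h : Tendsto a atTop (𝓝 a₀)) (q : ℂ) (n : ℕ) :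
    Tendsto (fun N => qShifted (a N) q n) atTop (𝓝 (qShifted a₀ q n)) :=
  tendsto_finsetProd _ fun k _ => (h.mul_const (q ^ k)).const_sub 1

theorem tendsto_tsum_qTerm {q : ℂ} {z a d : ℕ → ℂ} {z₀ a₀ b d₀ : ℂ} {r : ℝ} (hr : r < 1)
    (hq : ‖q‖ ≤ r) (hz : ∀ N, ‖z N‖ ≤ 1) (ha : ∀ N, ‖a N‖ ≤ 1) (hb : ‖b‖ ≤ 1)
    (hd : ∀ N, ‖d N‖ ≤ r) (hz₀ : Tendsto z atTop (𝓝 z₀)) (ha₀ : Tendsto a atTop (𝓝 a₀))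
    (hd₀ : Tendsto d atTop (𝓝 d₀)) :
    Tendsto (fun N => ∑' n, qTerm q (z N) (a N) b (d N) n) atTop
      (𝓝 (∑' n, qTerm q z₀ a₀ b d₀ n)) := by
  have hq1 : ‖q‖ < 1 := hq.trans_lt hr
  have hq2 : ‖q ^ 2‖ ≤ 1 := by rw [norm_pow]; exact pow_le_one₀ (norm_nonneg _) hq1.le
  have hdr : ‖d₀‖ < 1 := (le_of_tendsto' hd₀.norm hd).trans_lt hr
  refine tendsto_tsum_of_dominated_convergence
    (summable_pow_mul_pow_choose hq1 (4 / (1 - r) ^ 2)) (fun n => ?_)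
    (.of_forall fun N n => norm_qTerm_le hr hq (hz N) (ha N) hb (hd N) n)
  refine Tendsto.div ?_ ((tendsto_qShifted_left hd₀ _ n).const_mul _)
    (mul_ne_zero (qShifted_ne_zero hq1 hq1.le n) (qShifted_ne_zero hdr hq2 n))
  exact ((tendsto_qShifted_left ha₀ q n).mul_const _).mul ((hz₀.pow n).mul_const _)

/-- The ratio of consecutive terms, cleared of denominators. -/
theorem qTerm_succ {q d : ℂ} (hq : ‖q‖ < 1) (hd : ‖d‖ < 1) (z a b : ℂ) (n : ℕ) :
    qTerm q z a b d (n + 1) * ((1 - q ^ (n + 1)) * (1 - d * (q ^ n) ^ 2)) =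
      qTerm q z a b d n * ((1 - a * q ^ n) * (1 - b * q ^ n) * (z * q ^ n)) := by
  have hq2 : ‖q ^ 2‖ ≤ 1 := by rw [norm_pow]; exact pow_le_one₀ (norm_nonneg _) hq.le
  have h1 := qShifted_ne_zero hq hq.le n
  have h2 := qShifted_ne_zero hd hq2 n
  have h3 := one_sub_mul_pow_ne_zero hq hq.le n
  have h4 := one_sub_mul_pow_ne_zero hd hq2 n
  rw [← pow_mul, mul_comm 2 n, pow_mul] at h4
  rw [qTerm, qTerm, Nat.choose_succ_succ' n 1, Nat.choose_one_right]
  simp only [qShifted_succ]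
  rw [← pow_mul q 2 n, mul_comm 2 n, pow_mul q n 2, pow_succ' q n,
    div_mul_eq_mul_div, div_mul_eq_mul_div, div_eq_div_iff (by positivity) (by positivity)]
  ring

/-- Shifting `a` to `aq` and `d` to `dq²`: both factorials change only in their first and last
factors. -/
theorem qTerm_shift {q d : ℂ} (hq : ‖q‖ < 1) (hd : ‖d‖ < 1) (z a b : ℂ) (n : ℕ) :
    (1 - a) * qTerm q z (a * q) b (d * q ^ 2) n * (1 - d * (q ^ n) ^ 2) =
      qTerm q z a b d n * ((1 - a * q ^ n) * (1 - d)) := by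
  have hq2 : ‖q ^ 2‖ ≤ 1 := by rw [norm_pow]; exact pow_le_one₀ (norm_nonneg _) hq.le
  have h1 := qShifted_ne_zero hq hq.le n
  have h2 := qShifted_ne_zero hd hq2 n
  have hd2 : ‖d * q ^ 2‖ < 1 := (norm_mul_pow_le hq.le 2).trans_lt hd
  have h3 := qShifted_ne_zero hd2 hq2 n
  have e1 := one_sub_mul_qShifted a q n
  have e2 := one_sub_mul_qShifted d (q ^ 2) n
  rw [← pow_mul q 2 n, mul_comm 2 n, pow_mul q n 2] at e2
  rw [qTerm, qTerm, ← mul_div_assoc, div_mul_eq_mul_div, div_mul_eq_mul_div,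
    div_eq_div_iff (by positivity) (by positivity)]
  linear_combination qShifted b q n * q ^ n.choose 2 * z ^ n * qShifted q q n *
    (qShifted d (q ^ 2) n * (1 - d * (q ^ n) ^ 2) * e1 - qShifted a q n * (1 - a * q ^ n) * e2)

/-! ### Euler's sum and the second Gauss sum -/

theorem tsum_succ_eq_of_zero {f : ℕ → ℂ} (hf : Summable f) (h0 : f 0 = 0) :
    ∑' n, f (n + 1) = ∑' n, f n := by
  rw [hf.tsum_eq_zero_add, h0, zero_add]

theorem summable_one_sub_pow_mul_qTerm {q z a b d : ℂ} (hq : ‖q‖ < 1) (hz : ‖z‖ ≤ 1)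
    (ha : ‖a‖ ≤ 1) (hb : ‖b‖ ≤ 1) (hd : ‖d‖ < 1) :
    Summable fun n => (1 - q ^ n) * qTerm q z a b d n := by
  have hzq : ‖z * q‖ ≤ 1 := by simpa using (norm_mul_pow_le (d := z) hq.le 1).trans hz
  refine ((summable_qTerm hq hz ha hb hd).sub (summable_qTerm hq hzq ha hb hd)).congr fun n => ?_
  rw [qTerm_mul_right]
  ring

theorem tendsto_mul_pow_zero {r : ℂ} (hr : ‖r‖ < 1) (c : ℂ) :
    Tendsto (fun N : ℕ => c * r ^ N) atTop (𝓝 0) := by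
  simpa using (tendsto_pow_atTop_nhds_zero_of_norm_lt_one hr).const_mul c

/-- Euler's sum `∑ zⁿ q^{n(n-1)/2} / (q;q)_n = (-z;q)_∞`. -/
theorem euler_sum {q z : ℂ} (hq : ‖q‖ < 1) (hz : ‖z‖ ≤ 1) :
    ∑' n, qTerm q z 0 0 0 n = qShiftedInf (-z) q := by
  have h0 : ‖(0 : ℂ)‖ < 1 := by simp
  have step (w : ℂ) (hw : ‖w‖ ≤ 1) :
      ∑' n, qTerm q w 0 0 0 n = (1 + w) * ∑' n, qTerm q (w * q) 0 0 0 n := by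
    have hwq : ‖w * q‖ ≤ 1 := by simpa using (norm_mul_pow_le (d := w) hq.le 1).trans hw
    have hs := summable_qTerm hq hw h0.le h0.le h0
    have hs' := summable_qTerm hq hwq h0.le h0.le h0
    have e : ∑' n, (1 - q ^ n) * qTerm q w 0 0 0 n = w * ∑' n, qTerm q (w * q) 0 0 0 n := by
      rw [← tsum_succ_eq_of_zero (summable_one_sub_pow_mul_qTerm hq hw h0.le h0.le h0) (by simp),
        ← tsum_mul_left]
      refine tsum_congr fun n => ?_
      rw [qTerm_mul_right]
      linear_combination qTerm_succ hq h0 w 0 0 n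
    have e' : ∑' n, (1 - q ^ n) * qTerm q w 0 0 0 n =
        ∑' n, qTerm q w 0 0 0 n - ∑' n, qTerm q (w * q) 0 0 0 n := by
      rw [← hs.tsum_sub hs']
      refine tsum_congr fun n => ?_
      rw [qTerm_mul_right]
      ring
    linear_combination e - e'
  have hlim : Tendsto (fun N : ℕ => ∑' n, qTerm q (z * q ^ N) 0 0 0 n) atTop
      (𝓝 (∑' n, qTerm q 0 0 0 0 n)) :=
    tendsto_tsum_qTerm (a := fun _ => 0) (d := fun _ => 0) hq le_rfl
      (fun N => (norm_mul_pow_le hq.le N).trans hz) (fun _ => h0.le) h0.le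
      (fun _ => by simp) (tendsto_mul_pow_zero hq z) tendsto_const_nhds tendsto_const_nhds
  have h := mul_qShiftedInf_eq_of_rec (c := 0) (e := -z) hq hlim fun N => by
    rw [step _ ((norm_mul_pow_le hq.le N).trans hz), pow_succ, mul_assoc z]
    ring
  have h1 : ∑' n, qTerm q 0 0 0 0 n = 1 := by
    rw [tsum_eq_single 0 fun n hn => by simp [qTerm, hn]]
    simp [qTerm, qShifted]
  simpa [qShiftedInf_zero_left, h1] using h

/-- The contiguous relation `(1 - abq) G(a, b) = (1 - aq) G(aq², b)` for the second Gauss sum. -/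
theorem gauss_contiguous {q a b : ℂ} (hq : ‖q‖ < 1) (ha : ‖a‖ < 1) (hb : ‖b‖ ≤ 1) :
    (∑' n, qTerm q q a b (a * b * q) n) * (1 - a * b * q) =
      (1 - a * q) * ∑' n, qTerm q q (a * q ^ 2) b (a * q ^ 2 * b * q) n := by
  have hd : ‖a * b * q‖ < 1 := by
    rw [norm_mul, norm_mul]
    have := mul_le_one₀ ha.le (norm_nonneg _) hb
    nlinarith [norm_nonneg q, norm_nonneg a, norm_nonneg b]
  have hd' : ‖a * b * q * q ^ 2‖ < 1 := (norm_mul_pow_le hq.le 2).trans_lt hd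
  have ha' : ‖a * q ^ 2‖ ≤ 1 := (norm_mul_pow_le hq.le 2).trans ha.le
  have hs := summable_qTerm hq hq.le ha.le hb hd
  have hs' := summable_qTerm hq hq.le ha' hb hd'
  have hsu := summable_one_sub_pow_mul_qTerm hq hq.le ha.le hb hd
  have h1a := one_sub_ne_zero_of_norm_lt ha
  have hq2 : ‖q ^ 2‖ ≤ 1 := by rw [norm_pow]; exact pow_le_one₀ (norm_nonneg _) hq.le
  rw [show a * q ^ 2 * b * q = a * b * q * q ^ 2 by ring]
  -- The difference of the two sides telescopes: with `C = a (1 - abq) / (1 - a)`, its `n`-th term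
  -- is the forward difference of `C (1 - qⁿ) tₙ`, where `tₙ` is the term of `G(a, b)`.
  have key (n : ℕ) : (1 - a) * (qTerm q q a b (a * b * q) n * (1 - a * b * q) -
      (1 - a * q) * qTerm q q (a * q ^ 2) b (a * b * q * q ^ 2) n) =
      a * (1 - a * b * q) * ((1 - q ^ (n + 1)) * qTerm q q a b (a * b * q) (n + 1) -
        (1 - q ^ n) * qTerm q q a b (a * b * q) n) := by
    have hx : 1 - a * b * q * (q ^ n) ^ 2 ≠ 0 := by
      have := one_sub_mul_pow_ne_zero hd hq2 n
      rwa [← pow_mul, mul_comm 2 n, pow_mul] at this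
    have e1 := qTerm_succ hq hd q a b n
    -- `(a * q ^ 2; q)_n` is reached from `(a; q)_n` in two steps, `a * q` being the middle one.
    have e2 : (1 - a) * ((1 - a * q) * qTerm q q (a * q ^ 2) b (a * b * q * q ^ 2) n) *
        (1 - a * b * q * (q ^ n) ^ 2) = qTerm q q a b (a * b * q) n *
          ((1 - a * q ^ n) * (1 - a * q * q ^ n) * (1 - a * b * q)) := by
      have s1 := qTerm_shift hq hd q a b n
      have s2 : (1 - a * q) * qTerm q q (a * q ^ 2) b (a * b * q * q ^ 2) n =
          qTerm q q (a * q) b (a * b * q * q ^ 2) n * (1 - a * q * q ^ n) := by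
        have e := one_sub_mul_qShifted (a * q) q n
        rw [show a * q * q = a * q ^ 2 by ring] at e
        rw [qTerm, qTerm, ← mul_div_assoc, div_mul_eq_mul_div]
        congr 1
        linear_combination qShifted b q n * (q ^ n * q ^ n.choose 2) * e
      rw [s2]
      linear_combination (1 - a * q * q ^ n) * s1
    refine mul_right_cancel₀ hx ?_
    linear_combination -e2 - a * (1 - a * b * q) * e1
  have tel := tsum_succ_eq_of_zero hsu (by simp)
  have hsu1 := (summable_nat_add_iff 1).2 hsu
  have tot := tsum_congr (L := .unconditional ℕ) key
  rw [tsum_mul_left, tsum_mul_left, hsu1.tsum_sub hsu, tel, sub_self, mul_zero,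
    (hs.mul_right _).tsum_sub (hs'.mul_left _), tsum_mul_right, tsum_mul_left] at tot
  exact sub_eq_zero.1 ((mul_eq_zero.1 tot).resolve_left h1a)

/-- The contiguous relation iterated down to `a = 0`. -/
theorem gauss_reduce {q a b : ℂ} (hq : ‖q‖ < 1) (ha : ‖a‖ < 1) (hb : ‖b‖ ≤ 1) :
    (∑' n, qTerm q q a b (a * b * q) n) * qShiftedInf (a * b * q) (q ^ 2) =
      qShiftedInf (a * q) (q ^ 2) * ∑' n, qTerm q q 0 b 0 n := by
  have hq2 : ‖q ^ 2‖ < 1 := by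
    rw [norm_pow]; exact pow_lt_one₀ (norm_nonneg _) hq two_ne_zero
  have haN (N : ℕ) : ‖a * (q ^ 2) ^ N‖ < 1 := (norm_mul_pow_le hq2.le N).trans_lt ha
  have hlim : Tendsto (fun N : ℕ =>
      ∑' n, qTerm q q (a * (q ^ 2) ^ N) b (a * (q ^ 2) ^ N * b * q) n) atTop
      (𝓝 (∑' n, qTerm q q 0 b 0 n)) := by
    refine tendsto_tsum_qTerm (z := fun _ => q) hq le_rfl (fun _ => hq.le) (fun N => (haN N).le) hb
      (fun N => ?_) tendsto_const_nhds (tendsto_mul_pow_zero hq2 a) ?_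
    · rw [norm_mul, norm_mul]
      exact mul_le_of_le_one_left (norm_nonneg _) (mul_le_one₀ (haN N).le (norm_nonneg _) hb)
    · simpa [mul_assoc] using ((tendsto_mul_pow_zero hq2 a).mul_const b).mul_const q
  have h := mul_qShiftedInf_eq_of_rec (c := a * b * q) (e := a * q) hq2 hlim fun N => by
    have := gauss_contiguous hq (haN N) hb
    rw [show a * (q ^ 2) ^ (N + 1) = a * (q ^ 2) ^ N * q ^ 2 by ring]
    rw [show a * b * q * (q ^ 2) ^ N = a * (q ^ 2) ^ N * b * q by ring,
      show a * q * (q ^ 2) ^ N = a * (q ^ 2) ^ N * q by ring]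
    exact this
  simpa using h

/-- Andrews' `q`-analogue of Gauss' second summation theorem, cleared of the denominator. -/
theorem gauss_second {q a b : ℂ} (hq : ‖q‖ < 1) (ha : ‖a‖ < 1) (hb : ‖b‖ < 1) :
    (∑' n, qTerm q q a b (a * b * q) n) * qShiftedInf (a * b * q) (q ^ 2) =
      qShiftedInf (-q) q * (qShiftedInf (a * q) (q ^ 2) * qShiftedInf (b * q) (q ^ 2)) := by
  have h := gauss_reduce (b := 0) hq hb (by simp)
  simp only [mul_zero, zero_mul, qShiftedInf_zero_left, mul_one] at h
  rw [gauss_reduce hq ha hb.le, qTerm_comm, h, euler_sum hq hq.le]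
  ring

/-! ### The contiguous sum -/

/-- The series with `q^{n(n-1)/2}` and `(ab;q²)_n` is a combination of two second Gauss sums. -/
theorem contiguous_split {q a b : ℂ} (hq : ‖q‖ < 1) (ha : ‖a‖ < 1) (hb : ‖b‖ < 1) :
    (1 - a * b) * ∑' n, qTerm q 1 a b (a * b) n =
      (1 - a) * ∑' n, qTerm q q (a * q) b (a * q * b * q) n +
        (1 - b) * ∑' n, qTerm q q a (b * q) (a * (b * q) * q) n := by
  have hd : ‖a * b‖ < 1 := by
    rw [norm_mul]; exact mul_lt_one_of_nonneg_of_lt_one_left (norm_nonneg _) ha hb.le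
  have haq : ‖a * q‖ ≤ 1 := by simpa using (norm_mul_pow_le (d := a) hq.le 1).trans ha.le
  have hbq : ‖b * q‖ ≤ 1 := by simpa using (norm_mul_pow_le (d := b) hq.le 1).trans hb.le
  have hd' : ‖a * b * q ^ 2‖ < 1 := (norm_mul_pow_le hq.le 2).trans_lt hd
  have hq2 : ‖q ^ 2‖ ≤ 1 := by rw [norm_pow]; exact pow_le_one₀ (norm_nonneg _) hq.le
  have h1 : ‖(1 : ℂ)‖ ≤ 1 := by simp
  rw [show a * q * b * q = a * b * q ^ 2 by ring, show a * (b * q) * q = a * b * q ^ 2 by ring]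
  have hs := summable_qTerm hq h1 ha.le hb.le hd
  have hsq : Summable fun n => q ^ n * qTerm q 1 a b (a * b) n :=
    (summable_qTerm hq hq.le ha.le hb.le hd).congr fun n => by
      simpa [mul_comm] using qTerm_mul_right q 1 a b (a * b) n
  have hsu := summable_one_sub_pow_mul_qTerm hq h1 ha.le hb.le hd
  have hU := summable_qTerm hq hq.le haq hb.le hd'
  have hV := summable_qTerm hq hq.le ha.le hbq hd'
  -- With `x = a qⁿ`, `y = b qⁿ`, this rests on `(1 - x) + (1 - y) = (1 - x)(1 - y) + (1 - xy)`.
  have key (n : ℕ) : (1 - a) * qTerm q q (a * q) b (a * b * q ^ 2) n +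
      (1 - b) * qTerm q q a (b * q) (a * b * q ^ 2) n =
      (1 - a * b) * (q ^ n * qTerm q 1 a b (a * b) n +
        (1 - q ^ (n + 1)) * qTerm q 1 a b (a * b) (n + 1)) := by
    have hx : 1 - a * b * (q ^ n) ^ 2 ≠ 0 := by
      have := one_sub_mul_pow_ne_zero hd hq2 n
      rwa [← pow_mul, mul_comm 2 n, pow_mul] at this
    have e0 := qTerm_mul_right q 1 a b (a * b) n
    rw [one_mul] at e0
    have e1 := qTerm_shift hq hd q a b n
    have e2 := qTerm_shift hq hd q b a n
    rw [qTerm_comm q q (b * q) a, qTerm_comm q q b a, e0] at e2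
    rw [e0] at e1
    have e3 := qTerm_succ hq hd 1 a b n
    refine mul_right_cancel₀ hx ?_
    linear_combination e1 + e2 - (1 - a * b) * e3
  have tot := tsum_congr (L := .unconditional ℕ) key
  rw [(hU.mul_left _).tsum_add (hV.mul_left _), tsum_mul_left, tsum_mul_left, tsum_mul_left,
    hsq.tsum_add ((summable_nat_add_iff 1).2 hsu), tsum_succ_eq_of_zero hsu (by simp),
    ← hsq.tsum_add hsu] at tot
  rw [tot]
  congr 1
  exact tsum_congr fun n => by ring

/-- At `d = ab`, `z = 1` the two Gauss sums of `contiguous_split` share the denominator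
`(ab;q²)_∞`, because `(1 - ab) (abq²;q²)_∞ = (ab;q²)_∞`. -/
theorem contiguous_sum {q a b : ℂ} (hq : ‖q‖ < 1) (ha : ‖a‖ < 1) (hb : ‖b‖ < 1) :
    (∑' n, qTerm q 1 a b (a * b) n) * qShiftedInf (a * b) (q ^ 2) =
      qShiftedInf (-q) q * (qShiftedInf a (q ^ 2) * qShiftedInf (b * q) (q ^ 2) +
        qShiftedInf b (q ^ 2) * qShiftedInf (a * q) (q ^ 2)) := by
  have hq2 : ‖q ^ 2‖ < 1 := by
    rw [norm_pow]; exact pow_lt_one₀ (norm_nonneg _) hq two_ne_zero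
  have haq : ‖a * q‖ < 1 := by simpa using (norm_mul_pow_le (d := a) hq.le 1).trans_lt ha
  have hbq : ‖b * q‖ < 1 := by simpa using (norm_mul_pow_le (d := b) hq.le 1).trans_lt hb
  have h := contiguous_split hq ha hb
  have g1 := gauss_second hq haq hb
  have g2 := gauss_second hq ha hbq
  rw [show a * q * b * q = a * b * q ^ 2 by ring] at h g1
  rw [show a * (b * q) * q = a * b * q ^ 2 by ring] at h g2
  rw [mul_assoc a q q, ← sq] at g1
  rw [mul_assoc b q q, ← sq] at g2
  rw [← one_sub_mul_qShiftedInf (a * b) hq2, ← one_sub_mul_qShiftedInf a hq2,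
    ← one_sub_mul_qShiftedInf b hq2]
  linear_combination qShiftedInf (a * b * q ^ 2) (q ^ 2) * h + (1 - a) * g1 + (1 - b) * g2

/-! ### Specialization to base `q³` -/

theorem three_mul_sq_sub_div_two (n : ℕ) : (3 * n ^ 2 - 3 * n) / 2 = 3 * n.choose 2 := by
  rw [Nat.choose_two_right, ← Nat.mul_div_assoc _ (Nat.even_mul_pred_self n).two_dvd,
    Nat.mul_sub_one, Nat.mul_sub, sq]

theorem summand_eq_qTerm {q : ℂ} (hq : ‖q‖ < 1) (n : ℕ) :
    qShifted q q (3 * n) * qShifted (-q ^ 3) (q ^ 3) n /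
        (qShifted (q ^ 3) (q ^ 3) n * qShifted (q ^ 3) (q ^ 3) (2 * n)) *
      q ^ ((3 * n ^ 2 - 3 * n) / 2) = qTerm (q ^ 3) 1 q (q ^ 2) (q * q ^ 2) n := by
  have hp : ‖q ^ 3‖ < 1 := by
    rw [norm_pow]; exact pow_lt_one₀ (norm_nonneg _) hq three_ne_zero
  have hp2 : ‖(q ^ 3) ^ 2‖ ≤ 1 := by rw [norm_pow]; exact pow_le_one₀ (norm_nonneg _) hp.le
  have h1 := qShifted_ne_zero hp hp.le n
  have h2 : qShifted (-q ^ 3) (q ^ 3) n ≠ 0 := qShifted_ne_zero (by rwa [norm_neg]) hp.le n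
  have h3 := qShifted_ne_zero hp hp2 n
  rw [three_mul_sq_sub_div_two, pow_mul, qTerm, qShifted_three_mul, qShifted_two_mul,
    ← sq (q ^ 3), qShifted_sq, show q * q ^ 2 = q ^ 3 by ring, show q * q = q ^ 2 by ring, one_pow]
  field_simp

theorem mainTheorem2 (q : ℂ) (hq : ‖q‖ < 1) :
    HasSum
      (fun n : ℕ =>
        qShifted q q (3 * n) * qShifted (-q ^ 3) (q ^ 3) n /
            (qShifted (q ^ 3) (q ^ 3) n * qShifted (q ^ 3) (q ^ 3) (2 * n)) *
          q ^ ((3 * n ^ 2 - 3 * n) / 2))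
      (qShiftedInf (-q ^ 3) (q ^ 3) / qShiftedInf (q ^ 3) (q ^ 3) *
        (qShiftedInf q (q ^ 6) * qShiftedInf (q ^ 5) (q ^ 6) * qShiftedInf (q ^ 6) (q ^ 6) +
          qShiftedInf (q ^ 2) (q ^ 6) * qShiftedInf (q ^ 4) (q ^ 6) *
            qShiftedInf (q ^ 6) (q ^ 6))) := by
  have hpow (k : ℕ) (hk : k ≠ 0) : ‖q ^ k‖ < 1 := by
    rw [norm_pow]; exact pow_lt_one₀ (norm_nonneg _) hq hk
  have hp := hpow 3 three_ne_zero
  have hq2 := hpow 2 two_ne_zero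
  have hq6 := hpow 6 (by norm_num)
  simp only [summand_eq_qTerm hq]
  have hs : Summable (qTerm (q ^ 3) 1 q (q ^ 2) (q * q ^ 2)) :=
    summable_qTerm hp (by simp) hq.le hq2.le (by rwa [← pow_succ'])
  have h := contiguous_sum hp hq hq2
  have hsplit := qShiftedInf_eq_mul (q ^ 3) hp
  rw [show q ^ 3 * q ^ 3 = q ^ 6 by ring, show (q ^ 3) ^ 2 = q ^ 6 by ring] at hsplit
  have n1 := qShiftedInf_ne_zero hp hq6
  have n2 := qShiftedInf_ne_zero hq6 hq6
  convert hs.hasSum using 1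
  rw [show q * q ^ 2 = q ^ 3 by ring, show (q ^ 3) ^ 2 = q ^ 6 by ring,
    show q ^ 2 * q ^ 3 = q ^ 5 by ring, show q * q ^ 3 = q ^ 4 by ring] at h
  rw [show q * q ^ 2 = q ^ 3 by ring, hsplit]
  field_simp
  linear_combination -h
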